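/- Let $(\mathcal M,\omega)$ be a $2M$-dimensional smooth symplectic manifold with Poisson bracket $\{\cdot,\cdot\}$ (extended complex-bilinearly to complex-valued functions), and assume that its de Rham cohomology is trivial, i.e. every closed differential form of positive degree is exact. Let $C^\infty(\mathcal M)$ denote the smooth complex-valued functions, and let $\star$ be a star product on $C^\infty(\mathcal M)[[\hbar]]$: an associative $\mathbb C[[\hbar]]$-bilinear product with unit $1$ such that $A\star B=AB+O(\hbar)$ and $\{A,B\}_\star:=A\star B-B\star A=i\hbar\{A,B\}+O(\hbar^2)$. For $A=a+\hbar A_1+\cdots$ write $\pi A=a$. Let $J=\begin{pmatrix}0&I\\-I&0\end{pmatrix}$ be the constant $2M\times 2M$ matrix. Call $Z^1,\dots,Z^{2M}\in C^\infty(\mathcal M)[[\hbar]]$ s'Darboux coordinates if $\{Z^a,Z^b\}_\star=i\hbar J^{ab}$ for all $a,b$. Let $z^1,\dots,z^{2M}$ be global smooth (real) Darboux coordinates on $\mathcal M$, so $\{z^a,z^b\}=J^{ab}$. Then: (1) There exist s'Darboux coordinates $Z^i$ with $\pi Z^i=z^i$ for all $i$. (2) They are not unique: if $M\geq 1$ and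 $\mathcal M\neq\emptyset$, then for every such $Z$ there is another such $Z'\neq Z$. More precisely, let $Z$ be any s'Darboux coordinates with $\pi Z^i=z^i$ and let $n\ge 1$. For every $\gamma\in C^\infty(\mathcal M)$ there are $X^i\in C^\infty(\mathcal M)[[\hbar]]$ with $\pi X^i=\{\gamma,z^i\}$ such that $Z'^i=Z^i+\hbar^nX^i$ are again s'Darboux coordinates (with $\pi Z'^i=z^i$). Conversely, whenever $Z'^i=Z^i+\hbar^nX^i$ are again s'Darboux coordinates, there is some $\gamma\in C^\infty(\mathcal M)$ with $\pi X^i=\{\gamma,z^i\}$ for all $i$. -/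

import Mathlib

open scoped Manifold ContDiff PowerSeries

noncomputable section

/-! ### Differential forms on a smooth manifold -/

/-- A (not necessarily smooth) real differential `k`-form on a manifold `M` of dimension `d`. -/
abbrev DForm (d : ℕ) (M : Type*) [TopologicalSpace M]
    [ChartedSpace (EuclideanSpace ℝ (Fin d)) M] (k : ℕ) :=
  (p : M) → (TangentSpace (𝓡 d) p) [⋀^Fin k]→L[ℝ] ℝ

/-- The expression of a form in a chart `e`: its pull-back along `e.symm`. -/
def chartForm {d : ℕ} {M : Type*} [TopologicalSpace M]
    [ChartedSpace (EuclideanSpace ℝ (Fin d)) M] {k : ℕ} (α : DForm d M k)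
    (e : OpenPartialHomeomorph M (EuclideanSpace ℝ (Fin d)))
    (x : EuclideanSpace ℝ (Fin d)) :
    (EuclideanSpace ℝ (Fin d)) [⋀^Fin k]→L[ℝ] ℝ :=
  (α (e.symm x)).compContinuousLinearMap (mfderiv (𝓡 d) (𝓡 d) e.symm x)

/-- A form is smooth if it is smooth in every chart of the smooth structure. -/
def SmoothForm {d : ℕ} {M : Type*} [TopologicalSpace M]
    [ChartedSpace (EuclideanSpace ℝ (Fin d)) M] {k : ℕ} (α : DForm d M k) : Prop :=
  ∀ e ∈ IsManifold.maximalAtlas (𝓡 d) ∞ M, ContDiffOn ℝ ∞ (chartForm α e) e.target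

/-- `β = dα`: in every chart of the smooth structure, `β` is the exterior derivative of `α`. -/
def HasExtDeriv {d : ℕ} {M : Type*} [TopologicalSpace M]
    [ChartedSpace (EuclideanSpace ℝ (Fin d)) M] {k : ℕ} (α : DForm d M k)
    (β : DForm d M (k + 1)) : Prop :=
  ∀ e ∈ IsManifold.maximalAtlas (𝓡 d) ∞ M, ∀ x ∈ e.target,
    extDeriv (chartForm α e) x = chartForm β e x

/-- Trivial de Rham cohomology: in every positive degree, closed smooth forms are exact. -/
def TrivialCohomology (d : ℕ) (M : Type*) [TopologicalSpace M]
    [ChartedSpace (EuclideanSpace ℝ (Fin d)) M] : Prop :=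
  ∀ (k : ℕ) (α : DForm d M (k + 1)), SmoothForm α → HasExtDeriv α 0 →
    ∃ β : DForm d M k, SmoothForm β ∧ HasExtDeriv β α

/-! ### Symplectic forms and Poisson brackets -/

/-- A symplectic form: a smooth, closed, nondegenerate 2-form. -/
structure SymplecticForm (d : ℕ) (M : Type*) [TopologicalSpace M]
    [ChartedSpace (EuclideanSpace ℝ (Fin d)) M] where
  form : DForm d M 2
  smooth : SmoothForm form
  closed : HasExtDeriv form 0
  nondegenerate : ∀ (p : M) (v : TangentSpace (𝓡 d) p),
    (∀ w : TangentSpace (𝓡 d) p, form p ![v, w] = 0) → v = 0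

namespace SymplecticForm

variable {d : ℕ} {M : Type*} [TopologicalSpace M] [ChartedSpace (EuclideanSpace ℝ (Fin d)) M]

theorem update_zero {V : Type*} (v w x : V) : Function.update ![v, w] 0 x = ![x, w] := by
  ext i; fin_cases i <;> rfl

theorem update_one {V : Type*} (v w x : V) : Function.update ![v, w] 1 x = ![v, x] := by
  ext i; fin_cases i <;> rfl

/-- The map `v ↦ Ω(v, ·)` from tangent vectors to covectors. -/
def flat (Ω : SymplecticForm d M) (p : M) :
    TangentSpace (𝓡 d) p →ₗ[ℝ] Module.Dual ℝ (TangentSpace (𝓡 d) p) :=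
  LinearMap.mk₂ ℝ (fun v w => Ω.form p ![v, w])
    (fun v v' w => by
      have h := (Ω.form p).map_update_add ![v, w] 0 v v'
      rwa [update_zero, update_zero, update_zero] at h)
    (fun c v w => by
      have h := (Ω.form p).map_update_smul ![v, w] 0 c v
      rwa [update_zero, update_zero] at h)
    (fun v w w' => by
      have h := (Ω.form p).map_update_add ![v, w] 1 w w'
      rwa [update_one, update_one, update_one] at h)
    (fun c v w => by
      have h := (Ω.form p).map_update_smul ![v, w] 1 c w
      rwa [update_one, update_one] at h)

theorem exists_hamVec (Ω : SymplecticForm d M) (p : M)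
    (l : Module.Dual ℝ (TangentSpace (𝓡 d) p)) :
    ∃ v : TangentSpace (𝓡 d) p, ∀ w : TangentSpace (𝓡 d) p, Ω.form p ![v, w] = l w := by
  have : FiniteDimensional ℝ (TangentSpace (𝓡 d) p) :=
    inferInstanceAs (FiniteDimensional ℝ (EuclideanSpace ℝ (Fin d)))
  have hinj : Function.Injective (Ω.flat p) := by
    rw [injective_iff_map_eq_zero]
    intro v hv
    exact Ω.nondegenerate p v (fun w => LinearMap.congr_fun hv w)
  have hsurj : Function.Surjective (Ω.flat p) :=
    (LinearMap.injective_iff_surjective_of_finrank_eq_finrank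
      (Subspace.dual_finrank_eq).symm).1 hinj
  obtain ⟨v, hv⟩ := hsurj l
  exact ⟨v, fun w => LinearMap.congr_fun hv w⟩

/-- The value at `p` of the Hamiltonian vector field of `f`: the unique vector `X_f` with
`Ω(X_f, ·) = df`. -/
def hamVec (Ω : SymplecticForm d M) (f : M → ℝ) (p : M) : TangentSpace (𝓡 d) p :=
  (Ω.exists_hamVec p (mfderiv (𝓡 d) 𝓘(ℝ, ℝ) f p).toLinearMap).choose

theorem form_hamVec (Ω : SymplecticForm d M) (f : M → ℝ) (p : M)
    (w : TangentSpace (𝓡 d) p) :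
    Ω.form p ![Ω.hamVec f p, w] = mfderiv (𝓡 d) 𝓘(ℝ, ℝ) f p w :=
  (Ω.exists_hamVec p (mfderiv (𝓡 d) 𝓘(ℝ, ℝ) f p).toLinearMap).choose_spec w

/-- The Poisson bracket `{f, g} = Ω(X_f, X_g)` of real functions. With `Ω = dx ∧ dp` this is
`∂f/∂x ∂g/∂p - ∂f/∂p ∂g/∂x`, so that `{x, p} = 1`. -/
def bracketReal (Ω : SymplecticForm d M) (f g : M → ℝ) (p : M) : ℝ :=
  Ω.form p ![Ω.hamVec f p, Ω.hamVec g p]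

/-- The complex bilinear extension of the Poisson bracket to complex-valued functions. -/
def bracket (Ω : SymplecticForm d M) (f g : M → ℂ) (p : M) : ℂ :=
  ((Ω.bracketReal (fun q => (f q).re) (fun q => (g q).re) p
      - Ω.bracketReal (fun q => (f q).im) (fun q => (g q).im) p : ℝ) : ℂ)
    + Complex.I * ((Ω.bracketReal (fun q => (f q).re) (fun q => (g q).im) p
      + Ω.bracketReal (fun q => (f q).im) (fun q => (g q).re) p : ℝ) : ℂ)

end SymplecticForm

/-- The constant matrix `J = (0, I; -I, 0)`. -/
def canonicalJ (m : ℕ) : Matrix (Fin m ⊕ Fin m) (Fin m ⊕ Fin m) ℝ :=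
  Matrix.fromBlocks 0 1 (-1) 0

/-- Global smooth Darboux coordinates: `2m` smooth real functions, jointly injective, with
`{z^a, z^b} = J^{ab}`. The bracket relation makes the differentials `dz^a` a basis at every point,
so `z` is then a diffeomorphism onto an open subset of `ℝ^{2m}`. -/
structure IsDarboux {m : ℕ} {M : Type*} [TopologicalSpace M]
    [ChartedSpace (EuclideanSpace ℝ (Fin (2 * m))) M] (Ω : SymplecticForm (2 * m) M)
    (z : Fin m ⊕ Fin m → M → ℝ) : Prop where
  smooth : ∀ a, ContMDiff (𝓡 (2 * m)) 𝓘(ℝ, ℝ) ∞ (z a)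
  injective : Function.Injective (fun (p : M) (a : Fin m ⊕ Fin m) => z a p)
  bracket_eq : ∀ a b p, Ω.bracketReal (z a) (z b) p = canonicalJ m a b

/-! ### Symbols and star products -/

/-- The algebra `C^∞(M)` of smooth complex-valued functions. -/
def smoothAlg (d : ℕ) (M : Type*) [TopologicalSpace M]
    [ChartedSpace (EuclideanSpace ℝ (Fin d)) M] : Subalgebra ℂ (M → ℂ) where
  carrier := {f | ContMDiff (𝓡 d) 𝓘(ℝ, ℂ) ∞ f}
  mul_mem' := fun {f g} hf hg => by
    have h : ContDiff ℝ ∞ (fun q : ℂ × ℂ => q.1 * q.2) := contDiff_fst.mul contDiff_snd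
    exact h.contMDiff.comp (hf.prodMk_space hg)
  add_mem' := fun {f g} hf hg => by
    have h : ContDiff ℝ ∞ (fun q : ℂ × ℂ => q.1 + q.2) := contDiff_fst.add contDiff_snd
    exact h.contMDiff.comp (hf.prodMk_space hg)
  algebraMap_mem' := fun c => by
    exact contMDiff_const (c := c)

/-- The space `C^∞(M)[[ħ]]` of symbols; `ħ` is `PowerSeries.X`. -/
abbrev Symb (d : ℕ) (M : Type*) [TopologicalSpace M]
    [ChartedSpace (EuclideanSpace ℝ (Fin d)) M] := (smoothAlg d M)⟦X⟧

/-- The principal symbol `πA`, that is, the coefficient of `ħ^0`. -/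
def principal {d : ℕ} {M : Type*} [TopologicalSpace M]
    [ChartedSpace (EuclideanSpace ℝ (Fin d)) M] (A : Symb d M) : M → ℂ :=
  (PowerSeries.coeff 0 A : smoothAlg d M)

/-- A star product on a symplectic manifold: an associative unital `ℂ[[ħ]]`-bilinear product on
`C^∞(M)[[ħ]]` with `A ⋆ B = A B + O(ħ)` and `A ⋆ B - B ⋆ A = iħ {A, B} + O(ħ²)`. -/
structure StarProduct {d : ℕ} {M : Type*} [TopologicalSpace M]
    [ChartedSpace (EuclideanSpace ℝ (Fin d)) M] (Ω : SymplecticForm d M) where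
  star : Symb d M →ₗ[ℂ⟦X⟧] Symb d M →ₗ[ℂ⟦X⟧] Symb d M
  assoc : ∀ A B C, star (star A B) C = star A (star B C)
  one_star : ∀ A, star 1 A = A
  star_one : ∀ A, star A 1 = A
  coeff_zero : ∀ A B p, principal (star A B) p = principal A p * principal B p
  coeff_one : ∀ (A B : Symb d M) (p : M),
    (PowerSeries.coeff 1 (star A B - star B A) : smoothAlg d M).1 p
      = Complex.I * Ω.bracket (principal A) (principal B) p

namespace StarProduct

/-- The star commutator `{A, B}_⋆ = A ⋆ B - B ⋆ A`. -/
def comm {d : ℕ} {M : Type*} [TopologicalSpace M]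
    [ChartedSpace (EuclideanSpace ℝ (Fin d)) M] {Ω : SymplecticForm d M} (S : StarProduct Ω)
    (A B : Symb d M) : Symb d M :=
  S.star A B - S.star B A

/-- s'Darboux coordinates: `{Z^a, Z^b}_⋆ = iħ J^{ab}`. -/
def IsSDarboux {m : ℕ} {M : Type*} [TopologicalSpace M]
    [ChartedSpace (EuclideanSpace ℝ (Fin (2 * m))) M] {Ω : SymplecticForm (2 * m) M}
    (S : StarProduct Ω) (Z : Fin m ⊕ Fin m → Symb (2 * m) M) : Prop :=
  ∀ a b, S.comm (Z a) (Z b)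
    = PowerSeries.X * PowerSeries.C
        (algebraMap ℂ (smoothAlg (2 * m) M) (Complex.I * (canonicalJ m a b : ℂ)))

/-- `Z` are s'Darboux coordinates with principal symbols `z`. -/
def IsLift {m : ℕ} {M : Type*} [TopologicalSpace M]
    [ChartedSpace (EuclideanSpace ℝ (Fin (2 * m))) M] {Ω : SymplecticForm (2 * m) M}
    (S : StarProduct Ω) (z : Fin m ⊕ Fin m → M → ℝ)
    (Z : Fin m ⊕ Fin m → Symb (2 * m) M) : Prop :=
  S.IsSDarboux Z ∧ ∀ a p, principal (Z a) p = (z a p : ℂ)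

end StarProduct

end

/-!
The Darboux coordinates `z` form one global chart: the bracket relations force the Hamiltonian
vectors of the `z^a` to be carried by `dz` to a fixed basis of `ℝ^{2m}` (`hamFrame`), so `z` is an
injective local diffeomorphism, hence a chart of the maximal atlas with source the whole manifold
(`IsDarboux.exists_globalChart`). In this chart the operators `D_a = {·, z^a}` are the derivatives
along constant vectors. They commute, and for a form with coefficients in the frame `hamFrame`
exactness reads as follows, the cohomology being trivial: `D_a x^c = D_c x^a` implies `x^a = D_a γ`
(`IsDarboux.exists_deriv_eq`), and an antisymmetric `F` whose cyclic sum `D_a F^{ce} + ⋯` vanishes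
is of the form `F^{ac} = D_a f^c - D_c f^a` (`IsDarboux.exists_deriv_sub_deriv_eq`).

The quantum statement follows order by order in `ħ`. Let the relations
`{Z^a, Z^b}_⋆ = iħ J^{ab}` hold up to an error `ħ^{n+2} G^{ab}`. The Jacobi identity of the star
commutator says that the leading part of `G` is a closed 2-form; a primitive of it, added to `Z` at
order `ħ^{n+1}`, removes the error at order `ħ^{n+2}` (`StarProduct.exists_correction`). The
`ħ`-adic limit of the corrections is an exact solution that agrees with `Z` up to order `ħ^n`
(`StarProduct.exists_isLift_of_X_pow_dvd_defect`). Starting from `z` itself this gives existence;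
starting from `Z^a + ħ^n {γ, z^a}`, whose error is of order `ħ^{n+2}` because the `D_a` commute, it
gives the lift that belongs to `γ`. Conversely, comparing the relations for `Z` and for `Z + ħ^n X`
at order `ħ^{n+1}` says that `πX` is a closed 1-form, hence `πX^a = D_a γ`.
-/

noncomputable section

/-! ### Forms in a global chart -/

/-- On a finite-dimensional space an alternating-map-valued function is smooth as soon as its values
on fixed vectors are: evaluation on a basis is an injective linear map to a finite-dimensional
space, so it has a continuous linear left inverse. -/
theorem contDiffOn_continuousAlternatingMap_of_apply {E V : Type*} [NormedAddCommGroup E]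
    [NormedSpace ℝ E] [NormedAddCommGroup V] [NormedSpace ℝ V] [FiniteDimensional ℝ V] {k : ℕ}
    {n : WithTop ℕ∞} {f : E → V [⋀^Fin k]→L[ℝ] ℝ} {s : Set E}
    (h : ∀ v, ContDiffOn ℝ n (fun x => f x v) s) : ContDiffOn ℝ n f s := by
  let b := Module.finBasis ℝ V
  let L : (V [⋀^Fin k]→L[ℝ] ℝ) →ₗ[ℝ] ((Fin k → Fin (Module.finrank ℝ V)) → ℝ) :=
    { toFun := fun α j => α (fun i => b (j i))
      map_add' := fun _ _ => rfl
      map_smul' := fun _ _ => rfl }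
  have hL : Function.Injective L := by
    intro α η hαη
    refine ContinuousAlternatingMap.toAlternatingMap_injective ?_
    refine Module.Basis.ext_alternating b fun j _ => ?_
    exact congrFun hαη j
  have : FiniteDimensional ℝ (V [⋀^Fin k]→L[ℝ] ℝ) := FiniteDimensional.of_injective L hL
  obtain ⟨R, hR⟩ := L.exists_leftInverse_of_injective (LinearMap.ker_eq_bot.2 hL)
  have hf : f = fun x => R.toContinuousLinearMap (fun j => f x (fun i => b (j i))) := by
    funext x
    exact (LinearMap.congr_fun hR (f x)).symm
  rw [hf]
  exact R.toContinuousLinearMap.contDiff.comp_contDiffOn (contDiffOn_pi.2 fun j => h _)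

theorem ContDiffOn.continuousAlternatingMap_pullback {E V W : Type*} [NormedAddCommGroup E]
    [NormedSpace ℝ E] [NormedAddCommGroup V] [NormedSpace ℝ V] [FiniteDimensional ℝ V]
    [NormedAddCommGroup W] [NormedSpace ℝ W] {k : ℕ} {n : WithTop ℕ∞}
    {f : E → W [⋀^Fin k]→L[ℝ] ℝ} {g : E → V →L[ℝ] W} {s : Set E}
    (hf : ContDiffOn ℝ n f s) (hg : ContDiffOn ℝ n g s) :
    ContDiffOn ℝ n (fun x => (f x).compContinuousLinearMap (g x)) s := by
  refine contDiffOn_continuousAlternatingMap_of_apply fun v => ?_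
  have h1 : ContDiffOn ℝ n (fun x =>
      ContinuousMultilinearMap.compContinuousLinearMapContinuousMultilinear ℝ
        (fun _ : Fin k => V) (fun _ : Fin k => W) ℝ (fun _ => g x)) s :=
    (ContinuousMultilinearMap.contDiff _).comp_contDiffOn (contDiffOn_pi.2 fun _ => hg)
  have h2 := h1.clm_apply
    ((ContinuousAlternatingMap.toContinuousMultilinearMapCLM ℝ).contDiff.comp_contDiffOn hf)
  exact (ContinuousMultilinearMap.apply ℝ (fun _ : Fin k => V) ℝ v).contDiff.comp_contDiffOn h2

section GlobalChart

variable {d : ℕ} {M : Type*} [TopologicalSpace M] [ChartedSpace (EuclideanSpace ℝ (Fin d)) M]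
  {e c : OpenPartialHomeomorph M (EuclideanSpace ℝ (Fin d))}

/-- The form on `M` that pulls back `β` along the globally defined chart `e`. Only the values of
`β` on the range of `e` matter. -/
def formOfChart (e : OpenPartialHomeomorph M (EuclideanSpace ℝ (Fin d))) {k : ℕ}
    (β : EuclideanSpace ℝ (Fin d) → (EuclideanSpace ℝ (Fin d)) [⋀^Fin k]→L[ℝ] ℝ) : DForm d M k :=
  fun p => (β (e p)).compContinuousLinearMap (mfderiv (𝓡 d) (𝓡 d) e p)

theorem contDiffOn_transition {f : M → EuclideanSpace ℝ (Fin d)}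
    (hf : ContMDiff (𝓡 d) (𝓡 d) ∞ f) (hc : c ∈ IsManifold.maximalAtlas (𝓡 d) ∞ M) :
    ContDiffOn ℝ ∞ (f ∘ c.symm) c.target := by
  rw [← contMDiffOn_iff_contDiffOn]
  exact hf.comp_contMDiffOn (contMDiffOn_symm_of_mem_maximalAtlas hc)

theorem fderiv_transition {f : M → EuclideanSpace ℝ (Fin d)}
    (hf : ContMDiff (𝓡 d) (𝓡 d) ∞ f) (hc : c ∈ IsManifold.maximalAtlas (𝓡 d) ∞ M)
    {x : EuclideanSpace ℝ (Fin d)} (hx : x ∈ c.target) :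
    fderiv ℝ (f ∘ c.symm) x
      = (mfderiv (𝓡 d) (𝓡 d) f (c.symm x)).comp (mfderiv (𝓡 d) (𝓡 d) c.symm x) := by
  rw [← mfderiv_eq_fderiv]
  exact mfderiv_comp x (hf.mdifferentiable (by simp) _)
    ((contMDiffAt_symm_of_mem_maximalAtlas hc hx).mdifferentiableAt (by simp))

/-- In another chart `c`, the form `formOfChart e β` is the pull-back of `β` along the transition
map `e ∘ c.symm`. -/
theorem chartForm_formOfChart (he : ContMDiff (𝓡 d) (𝓡 d) ∞ e)
    (hc : c ∈ IsManifold.maximalAtlas (𝓡 d) ∞ M) {k : ℕ}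
    (β : EuclideanSpace ℝ (Fin d) → (EuclideanSpace ℝ (Fin d)) [⋀^Fin k]→L[ℝ] ℝ)
    {x : EuclideanSpace ℝ (Fin d)} (hx : x ∈ c.target) :
    chartForm (formOfChart e β) c x
      = (β ((e ∘ c.symm) x)).compContinuousLinearMap (fderiv ℝ (e ∘ c.symm) x) := by
  rw [fderiv_transition he hc hx]
  rfl

/-- If a chart of the maximal atlas is defined on all of `M`, trivial cohomology of `M` is a
Poincaré lemma for forms on the target of that chart. -/
theorem exists_primitive_of_globalChart (hM : TrivialCohomology d M)
    (he : e ∈ IsManifold.maximalAtlas (𝓡 d) ∞ M) (hes : e.source = Set.univ) {k : ℕ}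
    {β : EuclideanSpace ℝ (Fin d) → (EuclideanSpace ℝ (Fin d)) [⋀^Fin (k + 1)]→L[ℝ] ℝ}
    (hβ : ContDiffOn ℝ ∞ β e.target) (hdβ : ∀ x ∈ e.target, extDeriv β x = 0) :
    ∃ γ : EuclideanSpace ℝ (Fin d) → (EuclideanSpace ℝ (Fin d)) [⋀^Fin k]→L[ℝ] ℝ,
      ContDiffOn ℝ ∞ γ e.target ∧ ∀ x ∈ e.target, extDeriv γ x = β x := by
  have hmaps : ∀ p, e p ∈ e.target := fun p => e.map_source (hes ▸ Set.mem_univ p)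
  have hsm : ContMDiff (𝓡 d) (𝓡 d) ∞ e := by
    rw [← contMDiffOn_univ, ← hes]
    exact contMDiffOn_of_mem_maximalAtlas he
  obtain ⟨γ, hγ, hdγ⟩ := hM k (formOfChart e β) (by
      intro c hc
      refine ContDiffOn.congr ?_ fun x hx => chartForm_formOfChart hsm hc β hx
      have hT := contDiffOn_transition hsm hc
      exact (hβ.comp hT fun x _ => hmaps _).continuousAlternatingMap_pullback
        (hT.fderiv_of_isOpen c.open_target (by simp))) (by
      intro c hc x hx
      have hT := contDiffOn_transition hsm hc
      have hev : chartForm (formOfChart e β) c =ᶠ[nhds x] fun x =>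
          (β ((e ∘ c.symm) x)).compContinuousLinearMap (fderiv ℝ (e ∘ c.symm) x) :=
        Filter.eventuallyEq_of_mem (c.open_target.mem_nhds hx) fun y hy =>
          chartForm_formOfChart hsm hc β hy
      have hβx : DifferentiableAt ℝ β ((e ∘ c.symm) x) :=
        (hβ.contDiffAt (e.open_target.mem_nhds (hmaps _))).differentiableAt (by simp)
      rw [hev.extDeriv_eq, extDeriv_pullback (r := ∞) hβx
        (hT.contDiffAt (c.open_target.mem_nhds hx)) (by simpa using ENat.LEInfty.out),
        hdβ ((e ∘ c.symm) x) (hmaps _)]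
      rfl)
  -- in the chart `e` itself the transition map is the identity, so `formOfChart e β` reads as `β`
  refine ⟨chartForm γ e, hγ e he, fun x hx => ?_⟩
  rw [hdγ e he x hx, chartForm_formOfChart hsm he β hx]
  have hev : e ∘ e.symm =ᶠ[nhds x] id :=
    Filter.eventuallyEq_of_mem (e.open_target.mem_nhds hx) fun y hy => e.right_inv hy
  rw [hev.fderiv_eq, fderiv_id, hev.eq_of_nhds]
  rfl

/-- A smooth map with bijective differential has an invertible derivative in every chart. -/
theorem exists_equiv_hasFDerivAt_transition [IsManifold (𝓡 d) ∞ M]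
    {f : M → EuclideanSpace ℝ (Fin d)} (hf : ContMDiff (𝓡 d) (𝓡 d) ∞ f)
    (hbij : ∀ p, Function.Bijective (mfderiv (𝓡 d) (𝓡 d) f p))
    (hc : c ∈ atlas (EuclideanSpace ℝ (Fin d)) M) {x : EuclideanSpace ℝ (Fin d)}
    (hx : x ∈ c.target) :
    ∃ A : EuclideanSpace ℝ (Fin d) ≃L[ℝ] EuclideanSpace ℝ (Fin d),
      HasFDerivAt (f ∘ c.symm) (A : _ →L[ℝ] _) x := by
  have hc' : c ∈ IsManifold.maximalAtlas (𝓡 d) ∞ M := IsManifold.subset_maximalAtlas hc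
  have : IsManifold (𝓡 d) 1 M := IsManifold.of_le (n := ∞) (by simp)
  have hT := (contDiffOn_transition hf hc').contDiffAt (c.open_target.mem_nhds hx)
  have hb : Function.Bijective (fderiv ℝ (f ∘ c.symm) x) := by
    rw [fderiv_transition hf hc' hx]
    exact (hbij _).comp
      ((mdifferentiable_of_mem_atlas (I := 𝓡 d) hc).symm.mfderiv_bijective hx)
  refine ⟨ContinuousLinearEquiv.ofBijective (fderiv ℝ (f ∘ c.symm) x)
    (LinearMap.ker_eq_bot.2 hb.1) (LinearMap.range_eq_top.2 hb.2), ?_⟩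
  rw [ContinuousLinearEquiv.coe_ofBijective]
  exact (hT.differentiableAt (by simp)).hasFDerivAt

/-- An open partial homeomorphism that is globally smooth with bijective differential belongs to the
smooth structure; smoothness of its inverse is the inverse function theorem. -/
theorem mem_maximalAtlas_of_contMDiff_of_bijective [IsManifold (𝓡 d) ∞ M]
    (he : ContMDiff (𝓡 d) (𝓡 d) ∞ e)
    (hbij : ∀ p, Function.Bijective (mfderiv (𝓡 d) (𝓡 d) e p)) :
    e ∈ IsManifold.maximalAtlas (𝓡 d) ∞ M := by
  have key : ∀ c ∈ atlas (EuclideanSpace ℝ (Fin d)) M,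
      c.symm ≫ₕ e ∈ contDiffGroupoid ∞ (𝓡 d) := by
    intro c hc
    have hT := contDiffOn_transition he (IsManifold.subset_maximalAtlas (n := ∞) (I := 𝓡 d) hc)
    rw [contDiffGroupoid, mem_groupoid_of_pregroupoid]
    simp only [contDiffPregroupoid, modelWithCornersSelf_coe, modelWithCornersSelf_coe_symm,
      Function.id_comp, Function.comp_id, Set.preimage_id, Set.range_id, Set.inter_univ]
    refine ⟨hT.mono fun x hx => hx.1, fun y hy => ContDiffAt.contDiffWithinAt ?_⟩
    have hx : (c.symm ≫ₕ e).symm y ∈ c.target := ((c.symm ≫ₕ e).map_target hy).1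
    obtain ⟨A, hA⟩ := exists_equiv_hasFDerivAt_transition he hbij hc hx
    exact (c.symm ≫ₕ e).contDiffAt_symm hy hA
      (hT.contDiffAt (c.open_target.mem_nhds hx))
  refine mem_maximalAtlas_iff.2 fun c hc => ⟨?_, key c hc⟩
  have h := (contDiffGroupoid ∞ (𝓡 d)).symm (key c hc)
  rwa [OpenPartialHomeomorph.trans_symm_eq_symm_trans_symm,
    OpenPartialHomeomorph.symm_symm] at h

theorem isOpenMap_of_contMDiff_of_bijective [IsManifold (𝓡 d) ∞ M]
    {f : M → EuclideanSpace ℝ (Fin d)} (hf : ContMDiff (𝓡 d) (𝓡 d) ∞ f)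
    (hbij : ∀ p, Function.Bijective (mfderiv (𝓡 d) (𝓡 d) f p)) : IsOpenMap f := by
  rw [isOpenMap_iff_nhds_le]
  intro p
  set c := chartAt (EuclideanSpace ℝ (Fin d)) p
  have hp : p ∈ c.source := mem_chart_source _ p
  have hc : c ∈ atlas (EuclideanSpace ℝ (Fin d)) M := chart_mem_atlas _ p
  obtain ⟨A, hA⟩ := exists_equiv_hasFDerivAt_transition hf hbij hc (c.map_source hp)
  have hT := (contDiffOn_transition hf (IsManifold.subset_maximalAtlas (n := ∞) hc)).contDiffAt
    (c.open_target.mem_nhds (c.map_source hp))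
  have h := (hT.hasStrictFDerivAt' hA (by simp)).map_nhds_eq_of_equiv
  rw [← Filter.map_map, c.symm.map_nhds_eq (c.map_source hp), Function.comp_apply,
    c.left_inv hp] at h
  exact h.ge

end GlobalChart

/-! ### Darboux coordinates as a global chart -/

section DarbouxChart

theorem canonicalJ_antisymm (m : ℕ) (a b : Fin m ⊕ Fin m) :
    canonicalJ m a b = -canonicalJ m b a := by
  rcases a with i | i <;> rcases b with j | j <;>
    simp [canonicalJ, Matrix.one_apply, eq_comm]

/-- The identification of the coordinate labels `Fin m ⊕ Fin m` with `Fin (2 * m)`. -/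
def coordIndex (m : ℕ) : Fin m ⊕ Fin m ≃ Fin (2 * m) :=
  finSumFinEquiv.trans (finCongr (two_mul m).symm)

/-- The basis of `ℝ^{2m}` formed by the columns of `J`. It consists of the Hamiltonian vectors of
the Darboux coordinates, read in these coordinates: `X_{x^i} = -∂/∂p_i` and `X_{p_i} = ∂/∂x^i`. -/
def hamFrame (m : ℕ) :
    Module.Basis (Fin m ⊕ Fin m) ℝ (EuclideanSpace ℝ (Fin (2 * m))) :=
  (((EuclideanSpace.basisFun (Fin (2 * m)) ℝ).toBasis.reindex (coordIndex m).symm).reindex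
    (Equiv.sumComm _ _)).unitsSMul (Sum.elim (fun _ => -1) (fun _ => 1))

theorem hamFrame_apply (m : ℕ) (b : Fin m ⊕ Fin m) (i : Fin (2 * m)) :
    hamFrame m b i = canonicalJ m ((coordIndex m).symm i) b := by
  obtain ⟨a, rfl⟩ := (coordIndex m).surjective i
  rcases a with a | a <;> rcases b with b | b <;>
    simp [hamFrame, canonicalJ, Module.Basis.unitsSMul_apply, Matrix.one_apply,
      Units.smul_def]

variable {m : ℕ} {M : Type*} [TopologicalSpace M]
  [ChartedSpace (EuclideanSpace ℝ (Fin (2 * m))) M]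

/-- The Darboux coordinates bundled into one map to Euclidean space. -/
def coordMap (z : Fin m ⊕ Fin m → M → ℝ) (p : M) : EuclideanSpace ℝ (Fin (2 * m)) :=
  WithLp.toLp 2 fun i => z ((coordIndex m).symm i) p

variable {Ω : SymplecticForm (2 * m) M} {z : Fin m ⊕ Fin m → M → ℝ}

theorem SymplecticForm.bracketReal_eq_mfderiv (Ω : SymplecticForm (2 * m) M) (f g : M → ℝ) (p : M) :
    Ω.bracketReal f g p = mfderiv (𝓡 (2 * m)) 𝓘(ℝ, ℝ) f p (Ω.hamVec g p) :=
  Ω.form_hamVec f p _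

theorem SymplecticForm.bracketReal_antisymm (Ω : SymplecticForm (2 * m) M) (f g : M → ℝ) (p : M) :
    Ω.bracketReal f g p = -Ω.bracketReal g f p := by
  have h := (Ω.form p).map_swap ![Ω.hamVec g p, Ω.hamVec f p] (zero_ne_one (α := Fin 2))
  refine Eq.trans ?_ h
  refine congrArg (Ω.form p) ?_
  ext i : 1
  fin_cases i <;> rfl

theorem IsDarboux.contMDiff_coordMap (hz : IsDarboux Ω z) :
    ContMDiff (𝓡 (2 * m)) (𝓡 (2 * m)) ∞ (coordMap z) := by
  have h : ContMDiff (𝓡 (2 * m)) 𝓘(ℝ, Fin (2 * m) → ℝ) ∞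
      (fun p i => z ((coordIndex m).symm i) p) := contMDiff_pi_space.2 fun i => hz.smooth _
  exact (PiLp.continuousLinearEquiv 2 ℝ (fun _ : Fin (2 * m) => ℝ)).symm.contDiff.contMDiff.comp h

theorem IsDarboux.mfderiv_coordMap_hamVec (hz : IsDarboux Ω z) (a : Fin m ⊕ Fin m) (p : M) :
    mfderiv (𝓡 (2 * m)) (𝓡 (2 * m)) (coordMap z) p (Ω.hamVec (z a) p) = hamFrame m a := by
  refine PiLp.ext fun i => ?_
  rw [hamFrame_apply, ← hz.bracket_eq _ _ p, Ω.bracketReal_eq_mfderiv]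
  let L : EuclideanSpace ℝ (Fin (2 * m)) →L[ℝ] ℝ := EuclideanSpace.proj i
  have hL : z ((coordIndex m).symm i) = L ∘ coordMap z := rfl
  rw [hL, mfderiv_comp (I' := 𝓡 (2 * m)) p L.differentiableAt.mdifferentiableAt
    (hz.contMDiff_coordMap.mdifferentiable (by simp) p), mfderiv_eq_fderiv, L.fderiv]
  rfl

theorem IsDarboux.mfderiv_coordMap_bijective (hz : IsDarboux Ω z) (p : M) :
    Function.Bijective (mfderiv (𝓡 (2 * m)) (𝓡 (2 * m)) (coordMap z) p) := by
  let A : EuclideanSpace ℝ (Fin (2 * m)) →ₗ[ℝ] EuclideanSpace ℝ (Fin (2 * m)) :=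
    (mfderiv (𝓡 (2 * m)) (𝓡 (2 * m)) (coordMap z) p).toLinearMap
  have hs : Function.Surjective A := by
    rw [← LinearMap.range_eq_top, eq_top_iff, ← (hamFrame m).span_eq, Submodule.span_le]
    rintro _ ⟨a, rfl⟩
    exact ⟨Ω.hamVec (z a) p, hz.mfderiv_coordMap_hamVec a p⟩
  exact ⟨(LinearMap.injective_iff_surjective (f := A)).2 hs, hs⟩

/-- Darboux coordinates are a chart of the smooth structure with source `univ`, in which the bracket
with `z a` is the derivative along the constant vector `hamFrame m a`. The manifold has to be
nonempty for the inverse of the chart to be a total function. -/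
theorem IsDarboux.exists_globalChart [IsManifold (𝓡 (2 * m)) ∞ M] [Nonempty M]
    (hz : IsDarboux Ω z) :
    ∃ e ∈ IsManifold.maximalAtlas (𝓡 (2 * m)) ∞ M, e.source = Set.univ ∧
      ∀ f : M → ℝ, ContMDiff (𝓡 (2 * m)) 𝓘(ℝ, ℝ) ∞ f → ∀ a p,
        Ω.bracketReal f (z a) p = fderiv ℝ (f ∘ e.symm) (e p) (hamFrame m a) := by
  have hsm := hz.contMDiff_coordMap
  have hinj : Function.Injective (coordMap z) := by
    intro p q h
    refine hz.injective (funext fun a => ?_)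
    simpa [coordMap] using congrArg (fun v : EuclideanSpace ℝ (Fin (2 * m)) => v (coordIndex m a)) h
  have hemb : Topology.IsOpenEmbedding (coordMap z) :=
    .of_continuous_injective_isOpenMap hsm.continuous hinj
      (isOpenMap_of_contMDiff_of_bijective hsm hz.mfderiv_coordMap_bijective)
  let e := hemb.toOpenPartialHomeomorph
  have he : e ∈ IsManifold.maximalAtlas (𝓡 (2 * m)) ∞ M :=
    mem_maximalAtlas_of_contMDiff_of_bijective hsm hz.mfderiv_coordMap_bijective
  refine ⟨e, he, rfl, fun f hf a p => ?_⟩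
  have hfe : f = (f ∘ e.symm) ∘ e := funext fun q => congrArg f (e.left_inv (Set.mem_univ q)).symm
  have hes : ContDiffOn ℝ ∞ (f ∘ e.symm) e.target := by
    rw [← contMDiffOn_iff_contDiffOn]
    exact hf.comp_contMDiffOn (contMDiffOn_symm_of_mem_maximalAtlas he)
  have hd : DifferentiableAt ℝ (f ∘ e.symm) (e p) :=
    (hes.contDiffAt (e.open_target.mem_nhds (e.map_source (Set.mem_univ p)))).differentiableAt
      (by simp)
  rw [Ω.bracketReal_eq_mfderiv]
  conv_lhs => rw [hfe]
  rw [mfderiv_comp (I' := 𝓡 (2 * m)) p hd.mdifferentiableAt (hsm.mdifferentiable (by simp) p),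
    mfderiv_eq_fderiv, ← hz.mfderiv_coordMap_hamVec a p]
  rfl

end DarbouxChart

/-! ### Potentials of closed forms in Darboux coordinates -/

section Frame

variable {ι V : Type*} [NormedAddCommGroup V] [NormedSpace ℝ V]
  [FiniteDimensional ℝ V] (b : Module.Basis ι ℝ V)

/-- The 1-form whose value on the constant vector `b a` is the function `x a`. -/
def frameOneForm [Fintype ι] (x : ι → V → ℝ) (y : V) : V [⋀^Fin 1]→L[ℝ] ℝ :=
  ∑ a, x a y • ContinuousAlternatingMap.ofSubsingleton ℝ V ℝ (0 : Fin 1)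
    (b.coord a).toContinuousLinearMap

/-- The constant 2-form `b^a ∧ b^c` made of dual basis covectors. -/
def coordWedge (a c : ι) : V [⋀^Fin 2]→L[ℝ] ℝ :=
  ContinuousMultilinearMap.alternatization
    ((ContinuousMultilinearMap.mkPiAlgebra ℝ (Fin 2) ℝ).compContinuousLinearMap
      ![(b.coord a).toContinuousLinearMap, (b.coord c).toContinuousLinearMap])

/-- The 2-form `½ ∑ F^{ac} b^a ∧ b^c`, whose value on `(b a, b c)` is `F a c` when `F` is
antisymmetric. -/
def frameTwoForm [Fintype ι] (F : ι → ι → V → ℝ) (y : V) : V [⋀^Fin 2]→L[ℝ] ℝ :=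
  ∑ a, ∑ c, (2⁻¹ * F a c y) • coordWedge b a c

theorem frameOneForm_apply [Fintype ι] (x : ι → V → ℝ) (y : V) (v : Fin 1 → V) (a : ι)
    (hv : v 0 = b a) : frameOneForm b x y v = x a y := by
  classical
  simp [frameOneForm, hv, Finsupp.single_apply]

theorem coordWedge_apply (a c : ι) (v : Fin 2 → V) :
    coordWedge b a c v
      = b.coord a (v 0) * b.coord c (v 1) - b.coord a (v 1) * b.coord c (v 0) := by
  have h : (Finset.univ : Finset (Equiv.Perm (Fin 2))) = {1, Equiv.swap 0 1} := by decide
  rw [coordWedge, ContinuousMultilinearMap.alternatization_apply_apply, h,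
    Finset.sum_pair (by decide)]
  simp [Fin.prod_univ_two, sub_eq_add_neg]

theorem frameTwoForm_apply [Fintype ι] {F : ι → ι → V → ℝ}
    (hF : ∀ a c y, F a c y = -F c a y) (y : V) (v : Fin 2 → V) (a c : ι) (hv0 : v 0 = b a) (hv1 : v 1 = b c) :
    frameTwoForm b F y v = F a c y := by
  classical
  have h : ∀ i j, (2⁻¹ * F i j y) • coordWedge b i j v
      = 2⁻¹ * (if a = i then if c = j then F i j y else 0 else 0)
        - 2⁻¹ * (if c = i then if a = j then F i j y else 0 else 0) := by
    intro i j
    rw [coordWedge_apply, hv0, hv1]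
    simp only [Module.Basis.coord_apply, Module.Basis.repr_self, Finsupp.single_apply, smul_eq_mul]
    split_ifs <;> ring
  simp only [frameTwoForm, ContinuousAlternatingMap.sum_apply, ContinuousAlternatingMap.smul_apply,
    h, Finset.sum_sub_distrib, ← Finset.mul_sum, Finset.sum_ite_irrel, Finset.sum_ite_eq,
    Finset.sum_const_zero, Finset.mem_univ, if_true]
  rw [hF c a]
  ring

theorem contDiffOn_frameOneForm [Fintype ι] {x : ι → V → ℝ} {U : Set V}
    (hx : ∀ a, ContDiffOn ℝ ∞ (x a) U) : ContDiffOn ℝ ∞ (frameOneForm b x) U :=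
  ContDiffOn.sum fun a _ => (hx a).smul contDiffOn_const

theorem contDiffOn_frameTwoForm [Fintype ι] {F : ι → ι → V → ℝ} {U : Set V}
    (hF : ∀ a c, ContDiffOn ℝ ∞ (F a c) U) : ContDiffOn ℝ ∞ (frameTwoForm b F) U :=
  ContDiffOn.sum fun a _ => ContDiffOn.sum fun c _ =>
    (contDiffOn_const.mul (hF a c)).smul contDiffOn_const

theorem extDeriv_frameOneForm_eq_zero [Fintype ι] {x : ι → V → ℝ} {y : V}
    (hx : DifferentiableAt ℝ (frameOneForm b x) y)
    (h : ∀ a c, fderiv ℝ (x c) y (b a) = fderiv ℝ (x a) y (b c)) :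
    extDeriv (frameOneForm b x) y = 0 := by
  refine ContinuousAlternatingMap.toAlternatingMap_injective ?_
  refine Module.Basis.ext_alternating b fun j _ => ?_
  have h1 : ∀ (v : Fin 1 → V) a, v 0 = b a → (fun y => frameOneForm b x y v) = x a :=
    fun v a hv => funext fun y => frameOneForm_apply b x y v a hv
  refine (extDeriv_apply hx _).trans ?_
  rw [Fin.sum_univ_two, h1 _ (j 1) rfl, h1 _ (j 0) rfl, h (j 0) (j 1)]
  simp

theorem extDeriv_frameTwoForm_eq_zero [Fintype ι] {F : ι → ι → V → ℝ} {y : V}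
    (hd : DifferentiableAt ℝ (frameTwoForm b F) y) (hF : ∀ a c y, F a c y = -F c a y)
    (h : ∀ a c e, fderiv ℝ (F c e) y (b a) + fderiv ℝ (F e a) y (b c)
      + fderiv ℝ (F a c) y (b e) = 0) :
    extDeriv (frameTwoForm b F) y = 0 := by
  refine ContinuousAlternatingMap.toAlternatingMap_injective ?_
  refine Module.Basis.ext_alternating b fun j _ => ?_
  have h1 : ∀ (v : Fin 2 → V) a c, v 0 = b a → v 1 = b c →
      (fun y => frameTwoForm b F y v) = F a c :=
    fun v a c hv hv' => funext fun y => frameTwoForm_apply b hF y v a c hv hv'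
  have h2 : F (j 0) (j 2) = -F (j 2) (j 0) := funext fun y => hF _ _ y
  refine (extDeriv_apply hd _).trans ?_
  rw [Fin.sum_univ_three, h1 _ (j 1) (j 2) rfl rfl, h1 _ (j 0) (j 2) rfl rfl,
    h1 _ (j 0) (j 1) rfl rfl, h2, fderiv_neg]
  simpa using h (j 0) (j 1) (j 2)

end Frame

section Darboux

theorem comp_comp_chart_symm_eventuallyEq
    {M E : Type*} [TopologicalSpace M] [TopologicalSpace E]
    (e : OpenPartialHomeomorph M E) (g : E → ℝ) {y : E}
    (hy : y ∈ e.target) : (g ∘ e) ∘ e.symm =ᶠ[nhds y] g :=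
  Filter.eventuallyEq_of_mem (e.open_target.mem_nhds hy) fun _ hx => congrArg g (e.right_inv hx)

variable {m : ℕ} {M : Type*} [TopologicalSpace M]
  [ChartedSpace (EuclideanSpace ℝ (Fin (2 * m))) M]
  {Ω : SymplecticForm (2 * m) M} {z : Fin m ⊕ Fin m → M → ℝ}

theorem contDiffOn_comp_chart_symm
    {e : OpenPartialHomeomorph M (EuclideanSpace ℝ (Fin (2 * m)))}
    (he : e ∈ IsManifold.maximalAtlas (𝓡 (2 * m)) ∞ M) {f : M → ℝ}
    (hf : ContMDiff (𝓡 (2 * m)) 𝓘(ℝ, ℝ) ∞ f) : ContDiffOn ℝ ∞ (f ∘ e.symm) e.target := by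
  rw [← contMDiffOn_iff_contDiffOn]
  exact hf.comp_contMDiffOn (contMDiffOn_symm_of_mem_maximalAtlas he)

theorem contMDiff_comp_globalChart
    {e : OpenPartialHomeomorph M (EuclideanSpace ℝ (Fin (2 * m)))}
    (he : e ∈ IsManifold.maximalAtlas (𝓡 (2 * m)) ∞ M) (hes : e.source = Set.univ)
    {g : EuclideanSpace ℝ (Fin (2 * m)) → ℝ} (hg : ContDiffOn ℝ ∞ g e.target) :
    ContMDiff (𝓡 (2 * m)) 𝓘(ℝ, ℝ) ∞ (g ∘ e) := by
  rw [← contMDiffOn_univ, ← hes]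
  exact hg.contMDiffOn.comp (contMDiffOn_of_mem_maximalAtlas he) fun p hp => e.map_source hp

variable [IsManifold (𝓡 (2 * m)) ∞ M]

theorem IsDarboux.contMDiff_bracketReal (hz : IsDarboux Ω z) {f : M → ℝ}
    (hf : ContMDiff (𝓡 (2 * m)) 𝓘(ℝ, ℝ) ∞ f) (a : Fin m ⊕ Fin m) :
    ContMDiff (𝓡 (2 * m)) 𝓘(ℝ, ℝ) ∞ (Ω.bracketReal f (z a)) := by
  rcases isEmpty_or_nonempty M with hM | hM
  · exact fun p => isEmptyElim p
  obtain ⟨e, he, hes, hD⟩ := hz.exists_globalChart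
  have h : Ω.bracketReal f (z a) = (fun y => fderiv ℝ (f ∘ e.symm) y (hamFrame m a)) ∘ e :=
    funext fun p => hD f hf a p
  rw [h]
  exact contMDiff_comp_globalChart he hes
    (((contDiffOn_comp_chart_symm he hf).fderiv_of_isOpen e.open_target (by simp)).clm_apply
      contDiffOn_const)

/-- Bracketing with two Darboux coordinates commutes: second derivatives are symmetric. -/
theorem IsDarboux.bracketReal_comm (hz : IsDarboux Ω z) {f : M → ℝ}
    (hf : ContMDiff (𝓡 (2 * m)) 𝓘(ℝ, ℝ) ∞ f) (a c : Fin m ⊕ Fin m) (p : M) :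
    Ω.bracketReal (Ω.bracketReal f (z a)) (z c) p
      = Ω.bracketReal (Ω.bracketReal f (z c)) (z a) p := by
  have : Nonempty M := ⟨p⟩
  obtain ⟨e, he, hes, hD⟩ := hz.exists_globalChart
  have hp : e p ∈ e.target := e.map_source (hes ▸ Set.mem_univ p)
  have hg := (contDiffOn_comp_chart_symm he hf).contDiffAt (e.open_target.mem_nhds hp)
  have hg' : DifferentiableAt ℝ (fderiv ℝ (f ∘ e.symm)) (e p) :=
    (hg.fderiv_right (m := ∞) (by simp)).differentiableAt (by simp)
  have h : ∀ a c, Ω.bracketReal (Ω.bracketReal f (z a)) (z c) p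
      = fderiv ℝ (fderiv ℝ (f ∘ e.symm)) (e p) (hamFrame m c) (hamFrame m a) := by
    intro a c
    have ha : Ω.bracketReal f (z a) = (fun y => fderiv ℝ (f ∘ e.symm) y (hamFrame m a)) ∘ e :=
      funext fun p => hD f hf a p
    rw [hD _ (hz.contMDiff_bracketReal hf a) c p, ha,
      (comp_comp_chart_symm_eventuallyEq e _ hp).fderiv_eq,
      fderiv_clm_apply hg' (differentiableAt_const _)]
    simp
  rw [h, h]
  exact (hg.isSymmSndFDerivAt (by simpa using ENat.LEInfty.out)) _ _

/-- Closed 1-forms are exact, in terms of their components along the Hamiltonian vectors of `z`. -/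
theorem IsDarboux.exists_primitive_of_closed_one (hM : TrivialCohomology (2 * m) M)
    (hz : IsDarboux Ω z) {x : Fin m ⊕ Fin m → M → ℝ}
    (hx : ∀ a, ContMDiff (𝓡 (2 * m)) 𝓘(ℝ, ℝ) ∞ (x a))
    (h : ∀ a c p, Ω.bracketReal (x c) (z a) p = Ω.bracketReal (x a) (z c) p) :
    ∃ γ : M → ℝ, ContMDiff (𝓡 (2 * m)) 𝓘(ℝ, ℝ) ∞ γ ∧
      ∀ a p, Ω.bracketReal γ (z a) p = x a p := by
  rcases isEmpty_or_nonempty M with hE | hE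
  · exact ⟨0, fun p => isEmptyElim p, fun _ p => isEmptyElim p⟩
  obtain ⟨e, he, hes, hD⟩ := hz.exists_globalChart
  have hmaps : ∀ p, e p ∈ e.target := fun p => e.map_source (hes ▸ Set.mem_univ p)
  have hsymm : ∀ p, e.symm (e p) = p := fun p => e.left_inv (hes ▸ Set.mem_univ p)
  have hcd := contDiffOn_frameOneForm (hamFrame m) fun a => contDiffOn_comp_chart_symm he (hx a)
  obtain ⟨γ, hγ, hdγ⟩ := exists_primitive_of_globalChart hM he hes hcd fun y hy =>
    extDeriv_frameOneForm_eq_zero (hamFrame m)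
      ((hcd.contDiffAt (e.open_target.mem_nhds hy)).differentiableAt (by simp)) fun a c => by
        have := h a c (e.symm y)
        rwa [hD _ (hx c), hD _ (hx a), e.right_inv hy] at this
  have hγ' : ∀ v : Fin 0 → _, ContDiffOn ℝ ∞ (fun y => γ y v) e.target := fun v =>
    (ContinuousAlternatingMap.apply ℝ _ ℝ v).contDiff.comp_contDiffOn hγ
  refine ⟨(fun y => γ y ![]) ∘ e, contMDiff_comp_globalChart he hes (hγ' _), fun a p => ?_⟩
  rw [hD _ (contMDiff_comp_globalChart he hes (hγ' _)),
    (comp_comp_chart_symm_eventuallyEq e _ (hmaps p)).fderiv_eq]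
  have h1 := congrArg (fun α => α ![hamFrame m a]) (hdγ (e p) (hmaps p))
  simp only [frameOneForm_apply (hamFrame m) _ _ ![hamFrame m a] a rfl, Function.comp_apply,
    hsymm] at h1
  rw [← h1, extDeriv_apply
    ((hγ.contDiffAt (e.open_target.mem_nhds (hmaps p))).differentiableAt (by simp))]
  simp only [Subsingleton.elim _ (![] : Fin 0 → EuclideanSpace ℝ (Fin (2 * m)))]
  simp

/-- Closed 2-forms are exact, in terms of their components along the Hamiltonian vectors of `z`,
which commute, so that no Lie bracket terms appear. -/
theorem IsDarboux.exists_primitive_of_closed_two (hM : TrivialCohomology (2 * m) M)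
    (hz : IsDarboux Ω z) {F : Fin m ⊕ Fin m → Fin m ⊕ Fin m → M → ℝ}
    (hF : ∀ a c, ContMDiff (𝓡 (2 * m)) 𝓘(ℝ, ℝ) ∞ (F a c))
    (hanti : ∀ a c p, F a c p = -F c a p)
    (h : ∀ a c e p, Ω.bracketReal (F c e) (z a) p + Ω.bracketReal (F e a) (z c) p
      + Ω.bracketReal (F a c) (z e) p = 0) :
    ∃ f : Fin m ⊕ Fin m → M → ℝ, (∀ a, ContMDiff (𝓡 (2 * m)) 𝓘(ℝ, ℝ) ∞ (f a)) ∧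
      ∀ a c p, Ω.bracketReal (f c) (z a) p - Ω.bracketReal (f a) (z c) p = F a c p := by
  rcases isEmpty_or_nonempty M with hE | hE
  · exact ⟨0, fun _ p => isEmptyElim p, fun _ _ p => isEmptyElim p⟩
  obtain ⟨e, he, hes, hD⟩ := hz.exists_globalChart
  have hmaps : ∀ p, e p ∈ e.target := fun p => e.map_source (hes ▸ Set.mem_univ p)
  have hsymm : ∀ p, e.symm (e p) = p := fun p => e.left_inv (hes ▸ Set.mem_univ p)
  have hanti' : ∀ a c y, (F a c ∘ e.symm) y = -(F c a ∘ e.symm) y := fun a c y => hanti a c _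
  have hcd := contDiffOn_frameTwoForm (hamFrame m) fun a c =>
    contDiffOn_comp_chart_symm he (hF a c)
  obtain ⟨γ, hγ, hdγ⟩ := exists_primitive_of_globalChart hM he hes hcd fun y hy =>
    extDeriv_frameTwoForm_eq_zero (hamFrame m)
      ((hcd.contDiffAt (e.open_target.mem_nhds hy)).differentiableAt (by simp)) hanti'
      fun a c d => by
        have := h a c d (e.symm y)
        rwa [hD _ (hF c d), hD _ (hF d a), hD _ (hF a c), e.right_inv hy] at this
  have hγ' : ∀ v : Fin 1 → _, ContDiffOn ℝ ∞ (fun y => γ y v) e.target := fun v =>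
    (ContinuousAlternatingMap.apply ℝ _ ℝ v).contDiff.comp_contDiffOn hγ
  refine ⟨fun a => (fun y => γ y ![hamFrame m a]) ∘ e,
    fun a => contMDiff_comp_globalChart he hes (hγ' _), fun a c p => ?_⟩
  have hf : ∀ a c, Ω.bracketReal ((fun y => γ y ![hamFrame m c]) ∘ e) (z a) p
      = fderiv ℝ (fun y => γ y ![hamFrame m c]) (e p) (hamFrame m a) := by
    intro a c
    rw [hD _ (contMDiff_comp_globalChart he hes (hγ' _)),
      (comp_comp_chart_symm_eventuallyEq e _ (hmaps p)).fderiv_eq]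
  have h1 := congrArg (fun α => α ![hamFrame m a, hamFrame m c]) (hdγ (e p) (hmaps p))
  simp only [frameTwoForm_apply (hamFrame m) hanti' _ ![hamFrame m a, hamFrame m c] a c rfl rfl,
    Function.comp_apply, hsymm] at h1
  have h0 : ∀ i : Fin 2, i.removeNth ![hamFrame m a, hamFrame m c]
      = ![![hamFrame m a, hamFrame m c] (1 - i)] := by
    intro i
    ext j : 1
    fin_cases i <;> fin_cases j <;> rfl
  rw [hf, hf, ← h1, extDeriv_apply
    ((hγ.contDiffAt (e.open_target.mem_nhds (hmaps p))).differentiableAt (by simp))]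
  simp [Fin.sum_univ_two, h0, sub_eq_add_neg]

end Darboux

/-! ### Complex-valued functions -/

section ComplexDarboux

variable {m : ℕ} {M : Type*} [TopologicalSpace M]
  [ChartedSpace (EuclideanSpace ℝ (Fin (2 * m))) M]
  {Ω : SymplecticForm (2 * m) M} {z : Fin m ⊕ Fin m → M → ℝ}

theorem contMDiff_re (f : smoothAlg (2 * m) M) :
    ContMDiff (𝓡 (2 * m)) 𝓘(ℝ, ℝ) ∞ (fun q => (f.1 q).re) :=
  Complex.reCLM.contDiff.contMDiff.comp f.2

theorem contMDiff_im (f : smoothAlg (2 * m) M) :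
    ContMDiff (𝓡 (2 * m)) 𝓘(ℝ, ℝ) ∞ (fun q => (f.1 q).im) :=
  Complex.imCLM.contDiff.contMDiff.comp f.2

/-- The smooth complex function with given smooth real and imaginary parts. -/
def smoothOfReIm (f g : M → ℝ) (hf : ContMDiff (𝓡 (2 * m)) 𝓘(ℝ, ℝ) ∞ f)
    (hg : ContMDiff (𝓡 (2 * m)) 𝓘(ℝ, ℝ) ∞ g) : smoothAlg (2 * m) M :=
  ⟨fun p => ⟨f p, g p⟩, Complex.equivRealProdCLM.symm.contDiff.contMDiff.comp (hf.prodMk_space hg)⟩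

/-- A Darboux coordinate as an element of `C^∞(M)`. -/
def IsDarboux.coord (hz : IsDarboux Ω z) (a : Fin m ⊕ Fin m) : smoothAlg (2 * m) M :=
  ⟨fun p => (z a p : ℂ), Complex.ofRealCLM.contDiff.contMDiff.comp (hz.smooth a)⟩

theorem SymplecticForm.bracketReal_zero_right (Ω : SymplecticForm (2 * m) M) (f : M → ℝ) (p : M) :
    Ω.bracketReal f (fun _ => 0) p = 0 := by
  rw [Ω.bracketReal_antisymm, Ω.bracketReal_eq_mfderiv, mfderiv_const]
  exact neg_zero

theorem SymplecticForm.bracket_ofReal_right (Ω : SymplecticForm (2 * m) M) (f : M → ℂ) (g : M → ℝ)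
    (p : M) : Ω.bracket f (fun q => (g q : ℂ)) p
      = ⟨Ω.bracketReal (fun q => (f q).re) g p, Ω.bracketReal (fun q => (f q).im) g p⟩ := by
  apply Complex.ext <;> simp [bracket, Ω.bracketReal_zero_right]

variable [IsManifold (𝓡 (2 * m)) ∞ M]

/-- The operator `{·, z^a}` on `C^∞(M)`. It acts separately on real and imaginary parts since `z^a`
is real. -/
def IsDarboux.deriv (hz : IsDarboux Ω z) (a : Fin m ⊕ Fin m) (f : smoothAlg (2 * m) M) :
    smoothAlg (2 * m) M :=
  smoothOfReIm (Ω.bracketReal (fun q => (f.1 q).re) (z a))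
    (Ω.bracketReal (fun q => (f.1 q).im) (z a))
    (hz.contMDiff_bracketReal (contMDiff_re f) a) (hz.contMDiff_bracketReal (contMDiff_im f) a)

theorem IsDarboux.deriv_apply (hz : IsDarboux Ω z) (a : Fin m ⊕ Fin m) (f : smoothAlg (2 * m) M)
    (p : M) : (hz.deriv a f).1 p = Ω.bracket f.1 (fun q => (z a q : ℂ)) p :=
  (Ω.bracket_ofReal_right f.1 (z a) p).symm

theorem IsDarboux.deriv_comm (hz : IsDarboux Ω z) (a c : Fin m ⊕ Fin m)
    (f : smoothAlg (2 * m) M) : hz.deriv c (hz.deriv a f) = hz.deriv a (hz.deriv c f) :=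
  Subtype.ext <| funext fun p => Complex.ext (hz.bracketReal_comm (contMDiff_re f) a c p)
    (hz.bracketReal_comm (contMDiff_im f) a c p)

theorem IsDarboux.exists_deriv_eq (hM : TrivialCohomology (2 * m) M) (hz : IsDarboux Ω z)
    {x : Fin m ⊕ Fin m → smoothAlg (2 * m) M} (h : ∀ a c, hz.deriv a (x c) = hz.deriv c (x a)) :
    ∃ γ : smoothAlg (2 * m) M, ∀ a, hz.deriv a γ = x a := by
  have h' : ∀ a c p, (hz.deriv a (x c)).1 p = (hz.deriv c (x a)).1 p := fun a c p => by rw [h a c]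
  obtain ⟨γ₁, h₁, e₁⟩ := hz.exists_primitive_of_closed_one hM (fun a => contMDiff_re (x a))
    fun a c p => congrArg Complex.re (h' a c p)
  obtain ⟨γ₂, h₂, e₂⟩ := hz.exists_primitive_of_closed_one hM (fun a => contMDiff_im (x a))
    fun a c p => congrArg Complex.im (h' a c p)
  exact ⟨smoothOfReIm γ₁ γ₂ h₁ h₂, fun a => Subtype.ext <| funext fun p =>
    Complex.ext (e₁ a p) (e₂ a p)⟩

theorem IsDarboux.exists_deriv_sub_deriv_eq (hM : TrivialCohomology (2 * m) M)
    (hz : IsDarboux Ω z) {F : Fin m ⊕ Fin m → Fin m ⊕ Fin m → smoothAlg (2 * m) M}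
    (hanti : ∀ a c, F a c = -F c a)
    (h : ∀ a c e, hz.deriv a (F c e) + hz.deriv c (F e a) + hz.deriv e (F a c) = 0) :
    ∃ f : Fin m ⊕ Fin m → smoothAlg (2 * m) M,
      ∀ a c, hz.deriv a (f c) - hz.deriv c (f a) = F a c := by
  have h' : ∀ a c e p, (hz.deriv a (F c e)).1 p + (hz.deriv c (F e a)).1 p
      + (hz.deriv e (F a c)).1 p = 0 :=
    fun a c e p => congrArg (fun f : smoothAlg (2 * m) M => f.1 p) (h a c e)
  have hanti' : ∀ a c p, (F a c).1 p = -(F c a).1 p :=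
    fun a c p => congrArg (fun f : smoothAlg (2 * m) M => f.1 p) (hanti a c)
  obtain ⟨f₁, h₁, e₁⟩ := hz.exists_primitive_of_closed_two hM (fun a c => contMDiff_re (F a c))
    (fun a c p => congrArg Complex.re (hanti' a c p))
    fun a c e p => congrArg Complex.re (h' a c e p)
  obtain ⟨f₂, h₂, e₂⟩ := hz.exists_primitive_of_closed_two hM (fun a c => contMDiff_im (F a c))
    (fun a c p => congrArg Complex.im (hanti' a c p))
    fun a c e p => congrArg Complex.im (h' a c e p)
  exact ⟨fun a => smoothOfReIm (f₁ a) (f₂ a) (h₁ a) (h₂ a), fun a c => Subtype.ext <|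
    funext fun p => Complex.ext (e₁ a c p) (e₂ a c p)⟩

end ComplexDarboux

/-! ### Star commutators and lifts of Darboux coordinates -/

namespace StarProduct

section Commutator

variable {d : ℕ} {M : Type*} [TopologicalSpace M] [ChartedSpace (EuclideanSpace ℝ (Fin d)) M]
  {Ω : SymplecticForm d M} (S : StarProduct Ω)

theorem C_smul_symb (c : ℂ) (A : Symb d M) :
    (PowerSeries.C c : ℂ⟦X⟧) • A = PowerSeries.C (algebraMap ℂ (smoothAlg d M) c) * A := by
  rw [Algebra.smul_def, PowerSeries.algebraMap_apply'', PowerSeries.map_C]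

theorem X_pow_smul_symb (n : ℕ) (A : Symb d M) :
    (PowerSeries.X ^ n : ℂ⟦X⟧) • A = PowerSeries.X ^ n * A := by
  rw [Algebra.smul_def, PowerSeries.algebraMap_apply'', map_pow, PowerSeries.map_X]

theorem comm_antisymm (A B : Symb d M) : S.comm A B = -S.comm B A := by
  simp [comm]

theorem comm_add_left (A B C : Symb d M) : S.comm (A + B) C = S.comm A C + S.comm B C := by
  simp only [comm, map_add, LinearMap.add_apply]
  abel

theorem comm_add_right (A B C : Symb d M) : S.comm A (B + C) = S.comm A B + S.comm A C := by
  simp only [comm, map_add, LinearMap.add_apply]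
  abel

theorem comm_X_pow_mul_left (n : ℕ) (A B : Symb d M) :
    S.comm (PowerSeries.X ^ n * A) B = PowerSeries.X ^ n * S.comm A B := by
  simp only [comm, ← X_pow_smul_symb, map_smul, LinearMap.smul_apply, smul_sub]

theorem comm_X_pow_mul_right (n : ℕ) (A B : Symb d M) :
    S.comm A (PowerSeries.X ^ n * B) = PowerSeries.X ^ n * S.comm A B := by
  simp only [comm, ← X_pow_smul_symb, map_smul, LinearMap.smul_apply, smul_sub]

theorem comm_C_mul_right (c : ℂ) (A B : Symb d M) :
    S.comm A (PowerSeries.C (algebraMap ℂ (smoothAlg d M) c) * B)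
      = PowerSeries.C (algebraMap ℂ (smoothAlg d M) c) * S.comm A B := by
  simp only [comm, ← C_smul_symb, map_smul, LinearMap.smul_apply, smul_sub]

theorem comm_X_mul_C (A : Symb d M) (c : ℂ) :
    S.comm A (PowerSeries.X * PowerSeries.C (algebraMap ℂ (smoothAlg d M) c)) = 0 := by
  have h : S.comm A 1 = 0 := by simp [comm, S.one_star, S.star_one]
  have h1 : (PowerSeries.X * PowerSeries.C (algebraMap ℂ (smoothAlg d M) c) : Symb d M)
      = PowerSeries.X ^ 1 * (PowerSeries.C (algebraMap ℂ (smoothAlg d M) c) * 1) := by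
    rw [pow_one, mul_one]
  rw [h1, comm_X_pow_mul_right, comm_C_mul_right, h, mul_zero, mul_zero]

theorem comm_jacobi (A B C : Symb d M) :
    S.comm A (S.comm B C) + S.comm B (S.comm C A) + S.comm C (S.comm A B) = 0 := by
  simp only [comm, map_sub, LinearMap.sub_apply, S.assoc]
  abel

/-- Star commutators are `O(ħ)`. -/
theorem X_dvd_comm (A B : Symb d M) : PowerSeries.X ∣ S.comm A B := by
  rw [PowerSeries.X_dvd_iff, ← PowerSeries.coeff_zero_eq_constantCoeff_apply]
  refine Subtype.ext (funext fun p => ?_)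
  have h : principal (S.star A B) p - principal (S.star B A) p = 0 := by
    rw [S.coeff_zero, S.coeff_zero]
    ring
  simpa [comm, principal] using h

end Commutator

section Darboux

variable {m : ℕ} {M : Type*} [TopologicalSpace M]
  [ChartedSpace (EuclideanSpace ℝ (Fin (2 * m))) M]
  {Ω : SymplecticForm (2 * m) M} (S : StarProduct Ω) {z : Fin m ⊕ Fin m → M → ℝ}

/-- The error `{Z^a, Z^b}_⋆ - iħ J^{ab}` in the s'Darboux relations. -/
def defect (Z : Fin m ⊕ Fin m → Symb (2 * m) M) (a b : Fin m ⊕ Fin m) : Symb (2 * m) M :=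
  S.comm (Z a) (Z b) - PowerSeries.X * PowerSeries.C
    (algebraMap ℂ (smoothAlg (2 * m) M) (Complex.I * (canonicalJ m a b : ℂ)))

theorem isSDarboux_iff_defect {Z : Fin m ⊕ Fin m → Symb (2 * m) M} :
    S.IsSDarboux Z ↔ ∀ a b, S.defect Z a b = 0 :=
  forall₂_congr fun _ _ => sub_eq_zero.symm

theorem defect_antisymm (Z : Fin m ⊕ Fin m → Symb (2 * m) M) (a b : Fin m ⊕ Fin m) :
    S.defect Z a b = -S.defect Z b a := by
  have h : Complex.I * (canonicalJ m a b : ℂ) = -(Complex.I * (canonicalJ m b a : ℂ)) := by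
    rw [canonicalJ_antisymm]
    push_cast
    ring
  rw [defect, defect, S.comm_antisymm, h, map_neg, map_neg]
  ring

/-- The Jacobi identity passes from the commutators to their defects because constants are
central. -/
theorem defect_jacobi (Z : Fin m ⊕ Fin m → Symb (2 * m) M) (a b c : Fin m ⊕ Fin m) :
    S.comm (Z a) (S.defect Z b c) + S.comm (Z b) (S.defect Z c a)
      + S.comm (Z c) (S.defect Z a b) = 0 := by
  have h : ∀ a b c, S.comm (Z a) (S.defect Z b c) = S.comm (Z a) (S.comm (Z b) (Z c)) := by
    intro a b c
    have h1 := S.comm_add_right (Z a) (S.defect Z b c) (PowerSeries.X * PowerSeries.C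
      (algebraMap ℂ (smoothAlg (2 * m) M) (Complex.I * (canonicalJ m b c : ℂ))))
    rw [comm_X_mul_C, add_zero, defect, sub_add_cancel] at h1
    exact h1.symm
  rw [h, h, h, comm_jacobi]

theorem defect_add (Z A : Fin m ⊕ Fin m → Symb (2 * m) M) (n : ℕ) (a b : Fin m ⊕ Fin m) :
    S.defect (fun a => Z a + PowerSeries.X ^ n * A a) a b
      = S.defect Z a b + PowerSeries.X ^ n * (S.comm (Z a) (A b) + S.comm (A a) (Z b))
        + PowerSeries.X ^ (2 * n) * S.comm (A a) (A b) := by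
  simp only [defect, comm_add_left, comm_add_right, comm_X_pow_mul_left, comm_X_pow_mul_right]
  ring

theorem X_sq_dvd_iff_coeff_one {R : Type*} [CommRing R] {A : R⟦X⟧} (h : PowerSeries.X ∣ A) :
    PowerSeries.X ^ 2 ∣ A ↔ PowerSeries.coeff 1 A = 0 := by
  rw [PowerSeries.X_pow_dvd_iff]
  refine ⟨fun h => h 1 (by norm_num), fun h1 k hk => ?_⟩
  interval_cases k
  · rwa [PowerSeries.coeff_zero_eq_constantCoeff_apply, ← PowerSeries.X_dvd_iff]
  · exact h1

theorem principal_add_X_pow_mul {Z A : Symb (2 * m) M} {n : ℕ} (hn : 1 ≤ n) :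
    principal (Z + PowerSeries.X ^ n * A) = principal Z := by
  have : n ≠ 0 := by omega
  simp [principal, this]

variable [IsManifold (𝓡 (2 * m)) ∞ M]

theorem coeff_one_comm_coord (hz : IsDarboux Ω z) {A B : Symb (2 * m) M} {a : Fin m ⊕ Fin m}
    (hB : ∀ p, principal B p = (z a p : ℂ)) :
    PowerSeries.coeff 1 (S.comm A B) = Complex.I • hz.deriv a (PowerSeries.coeff 0 A) := by
  refine Subtype.ext (funext fun p => ?_)
  refine (S.coeff_one A B p).trans ?_
  rw [funext hB]
  exact congrArg (Complex.I * ·) (hz.deriv_apply a _ p).symm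

/-- The first-order variation of the commutators under `Z ↦ Z + ħ^n A` is, up to sign and a factor
`i`, the exterior derivative of the 1-form with components `πA`. -/
theorem coeff_one_comm_add_comm (hz : IsDarboux Ω z) {Z : Fin m ⊕ Fin m → Symb (2 * m) M}
    (hZ : ∀ a p, principal (Z a) p = (z a p : ℂ)) (A : Fin m ⊕ Fin m → Symb (2 * m) M)
    (a b : Fin m ⊕ Fin m) :
    PowerSeries.coeff 1 (S.comm (Z a) (A b) + S.comm (A a) (Z b))
      = Complex.I • (hz.deriv b (PowerSeries.coeff 0 (A a))
        - hz.deriv a (PowerSeries.coeff 0 (A b))) := by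
  rw [S.comm_antisymm (Z a), map_add, map_neg, S.coeff_one_comm_coord hz (hZ a),
    S.coeff_one_comm_coord hz (hZ b), smul_sub]
  abel

/-- One step of the induction: an error of order `ħ^{n+2}` can be improved by one order by a change
of `Z` at order `ħ^{n+1}`. -/
theorem exists_correction (hM : TrivialCohomology (2 * m) M) (hz : IsDarboux Ω z)
    {Z : Fin m ⊕ Fin m → Symb (2 * m) M} (hZ : ∀ a p, principal (Z a) p = (z a p : ℂ)) {n : ℕ}
    (hd : ∀ a b, PowerSeries.X ^ (n + 2) ∣ S.defect Z a b) :
    ∃ A : Fin m ⊕ Fin m → Symb (2 * m) M, ∀ a b,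
      PowerSeries.X ^ (n + 3) ∣ S.defect (fun a => Z a + PowerSeries.X ^ (n + 1) * A a) a b := by
  choose G hG using hd
  have hGanti : ∀ a b, G a b = -G b a := by
    intro a b
    have h : PowerSeries.X ^ (n + 2) * (-G b a) = -(PowerSeries.X ^ (n + 2) * G b a) := by ring
    apply PowerSeries.X_pow_mul_cancel (k := n + 2)
    rw [h, ← hG, ← hG, S.defect_antisymm]
  -- a correction `f` has to satisfy `g^{ab} + i(D_b f^a - D_a f^b) = 0` with `g` the leading
  -- part of the error, that is, `df = -i g`
  let F : Fin m ⊕ Fin m → Fin m ⊕ Fin m → Symb (2 * m) M := fun a b =>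
    PowerSeries.C (algebraMap ℂ (smoothAlg (2 * m) M) (-Complex.I)) * G a b
  have hjac : ∀ a b c, S.comm (F b c) (Z a) + S.comm (F c a) (Z b) + S.comm (F a b) (Z c) = 0 := by
    intro a b c
    have h := S.defect_jacobi Z a b c
    rw [hG, hG, hG, comm_X_pow_mul_right, comm_X_pow_mul_right, comm_X_pow_mul_right, ← mul_add,
      ← mul_add] at h
    have h' : S.comm (Z a) (G b c) + S.comm (Z b) (G c a) + S.comm (Z c) (G a b) = 0 :=
      PowerSeries.X_pow_mul_cancel (k := n + 2) (by rw [h, mul_zero])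
    simp only [F, S.comm_antisymm _ (Z _), comm_C_mul_right]
    rw [← neg_add, ← neg_add, ← mul_add, ← mul_add, h', mul_zero, neg_zero]
  obtain ⟨f, hf⟩ := hz.exists_deriv_sub_deriv_eq hM
    (F := fun a b => PowerSeries.coeff 0 (F a b)) (fun a b => by
      simp only [F, PowerSeries.coeff_C_mul]
      rw [hGanti, map_neg (PowerSeries.coeff 0) (G b a)]
      ring) (fun a b c => by
      have h := congrArg (PowerSeries.coeff 1) (hjac a b c)
      rw [map_add, map_add, S.coeff_one_comm_coord hz (hZ _), S.coeff_one_comm_coord hz (hZ _),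
        S.coeff_one_comm_coord hz (hZ _), ← smul_add, ← smul_add, map_zero] at h
      exact (smul_eq_zero_iff_right Complex.I_ne_zero).1 h)
  refine ⟨fun a => PowerSeries.C (f a), fun a b => ?_⟩
  rw [defect_add, hG]
  set W := S.comm (Z a) (PowerSeries.C (f b)) + S.comm (PowerSeries.C (f a)) (Z b) with hW
  have hXW : PowerSeries.X ∣ W := dvd_add (S.X_dvd_comm _ _) (S.X_dvd_comm _ _)
  have h1 : PowerSeries.X ^ 2 ∣ PowerSeries.X * G a b + W := by
    rw [X_sq_dvd_iff_coeff_one (dvd_add (dvd_mul_right _ _) hXW), map_add, hW,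
      S.coeff_one_comm_add_comm hz hZ (fun a => PowerSeries.C (f a))]
    have h2 := hf b a
    simp only [F, PowerSeries.coeff_C_mul] at h2
    rw [PowerSeries.coeff_succ_X_mul, PowerSeries.coeff_zero_C, PowerSeries.coeff_zero_C, h2,
      hGanti b a, ← Algebra.smul_def, smul_smul, map_neg]
    simp
  have h3 : PowerSeries.X ^ (n + 2) * G a b + PowerSeries.X ^ (n + 1) * W
      = PowerSeries.X ^ (n + 1) * (PowerSeries.X * G a b + W) := by ring
  rw [h3]
  refine dvd_add ?_ ?_
  · rw [show n + 3 = (n + 1) + 2 by ring, pow_add]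
    exact mul_dvd_mul_left _ h1
  -- the quadratic term `ħ^{2n+2} {f^a, f^b}_⋆` is `O(ħ^{2n+3})`
  · refine (pow_dvd_pow _ (by omega : n + 3 ≤ 2 * (n + 1) + 1)).trans ?_
    rw [pow_succ]
    exact mul_dvd_mul_left _ (S.X_dvd_comm _ _)

/-- An approximate lift with error of order `ħ^{n+2}` agrees with an exact lift up to and including
order `ħ^n`. -/
theorem exists_isLift_of_X_pow_dvd_defect (hM : TrivialCohomology (2 * m) M) (hz : IsDarboux Ω z)
    {Z : Fin m ⊕ Fin m → Symb (2 * m) M} (hZ : ∀ a p, principal (Z a) p = (z a p : ℂ)) {n : ℕ}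
    (hd : ∀ a b, PowerSeries.X ^ (n + 2) ∣ S.defect Z a b) :
    ∃ Z', S.IsLift z Z' ∧ ∀ a, PowerSeries.X ^ (n + 1) ∣ Z' a - Z a := by
  have step : ∀ (k : ℕ) (Y : Fin m ⊕ Fin m → Symb (2 * m) M),
      ∃ Y' : Fin m ⊕ Fin m → Symb (2 * m) M,
      ((∀ a p, principal (Y a) p = (z a p : ℂ)) ∧
        ∀ a b, PowerSeries.X ^ (n + k + 2) ∣ S.defect Y a b) →
      ((∀ a p, principal (Y' a) p = (z a p : ℂ)) ∧
        ∀ a b, PowerSeries.X ^ (n + (k + 1) + 2) ∣ S.defect Y' a b) ∧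
      ∀ a, PowerSeries.X ^ (n + k + 1) ∣ Y' a - Y a := by
    intro k Y
    by_cases hY : (∀ a p, principal (Y a) p = (z a p : ℂ)) ∧
        ∀ a b, PowerSeries.X ^ (n + k + 2) ∣ S.defect Y a b
    · obtain ⟨A, hA⟩ := S.exists_correction hM hz hY.1 hY.2
      refine ⟨_, fun _ => ⟨⟨fun a p => ?_, hA⟩, fun a => ?_⟩⟩
      · rw [principal_add_X_pow_mul (by omega)]
        exact hY.1 a p
      · rw [add_sub_cancel_left]
        exact dvd_mul_right _ _
    · exact ⟨Y, fun h => absurd h hY⟩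
  choose next hnext using step
  let Y : ℕ → Fin m ⊕ Fin m → Symb (2 * m) M := fun k => Nat.rec Z next k
  have hY : ∀ k, (∀ a p, principal (Y k a) p = (z a p : ℂ)) ∧
      ∀ a b, PowerSeries.X ^ (n + k + 2) ∣ S.defect (Y k) a b := by
    intro k
    induction k with
    | zero => exact ⟨hZ, hd⟩
    | succ k ih => exact (hnext k (Y k) ih).1
  have hdiff : ∀ k j a, PowerSeries.X ^ (n + k + 1) ∣ Y (k + j) a - Y k a := by
    intro k j a
    induction j with
    | zero => simp
    | succ j ih =>
      have h := (hnext (k + j) (Y (k + j)) (hY _)).2 a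
      rw [← sub_add_sub_cancel _ (Y (k + j) a)]
      exact dvd_add ((pow_dvd_pow _ (by omega)).trans h) ih
  -- the `ħ`-adic limit: the `j`-th coefficient is final from the `j`-th stage on
  let L : Fin m ⊕ Fin m → Symb (2 * m) M := fun a =>
    PowerSeries.mk fun j => PowerSeries.coeff j (Y j a)
  have hL : ∀ k a, PowerSeries.X ^ (n + k + 1) ∣ L a - Y k a := by
    intro k a
    rw [PowerSeries.X_pow_dvd_iff]
    intro j hj
    rw [map_sub, PowerSeries.coeff_mk, sub_eq_zero]
    rcases le_total j k with hjk | hjk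
    · obtain ⟨i, rfl⟩ := Nat.exists_eq_add_of_le hjk
      have h := PowerSeries.X_pow_dvd_iff.1 (hdiff j i a) j (by omega)
      rw [map_sub, sub_eq_zero] at h
      exact h.symm
    · obtain ⟨i, rfl⟩ := Nat.exists_eq_add_of_le hjk
      have h := PowerSeries.X_pow_dvd_iff.1 (hdiff k i a) (k + i) hj
      rwa [map_sub, sub_eq_zero] at h
  refine ⟨L, ⟨S.isSDarboux_iff_defect.2 fun a b => ?_, fun a p => ?_⟩, hL 0⟩
  swap
  · rw [← (hY 0).1 a p, principal, principal, PowerSeries.coeff_mk]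
  have hdvd : ∀ k, PowerSeries.X ^ (k + 1) ∣ S.defect L a b := by
    intro k
    choose R hR using fun a => hL k a
    -- `L` is a change of the `k`-th stage at an order where `defect_add` only adds `O(ħ^{k+1})`
    have hLR : L = fun a => Y k a + PowerSeries.X ^ (n + k + 1) * R a := by
      funext a
      rw [← hR, add_sub_cancel]
    rw [hLR, defect_add]
    refine dvd_add (dvd_add ?_ ?_) ?_
    · exact (pow_dvd_pow _ (by omega)).trans ((hY k).2 a b)
    · exact (pow_dvd_pow _ (by omega)).trans (dvd_mul_right _ _)
    · exact (pow_dvd_pow _ (by omega)).trans (dvd_mul_right _ _)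
  ext1 k
  rw [map_zero]
  exact PowerSeries.X_pow_dvd_iff.1 (hdvd k) k (by omega)

theorem exists_isLift (hM : TrivialCohomology (2 * m) M) (hz : IsDarboux Ω z) :
    ∃ Z, S.IsLift z Z := by
  have hπ : ∀ a p, principal (PowerSeries.C (hz.coord a)) p = (z a p : ℂ) := fun a p => by
    rw [principal, PowerSeries.coeff_zero_C]
    rfl
  obtain ⟨Z, hZ, -⟩ := S.exists_isLift_of_X_pow_dvd_defect hM hz hπ (n := 0) fun a b => by
    rw [zero_add, defect, X_sq_dvd_iff_coeff_one (dvd_sub (S.X_dvd_comm _ _) (dvd_mul_right _ _)),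
      map_sub,
      S.coeff_one_comm_coord hz (hπ b), PowerSeries.coeff_succ_X_mul, PowerSeries.coeff_zero_C,
      PowerSeries.coeff_zero_C, sub_eq_zero]
    refine Subtype.ext (funext fun p => congrArg (Complex.I * ·) ?_)
    rw [hz.deriv_apply, Ω.bracket_ofReal_right]
    apply Complex.ext
    · exact hz.bracket_eq a b p
    · refine (Ω.bracketReal_antisymm _ _ p).trans ?_
      refine (congrArg Neg.neg (Ω.bracketReal_zero_right (z b) p)).trans ?_
      simp
  exact ⟨Z, hZ⟩

theorem exists_isLift_add_X_pow_mul (hM : TrivialCohomology (2 * m) M) (hz : IsDarboux Ω z)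
    {Z : Fin m ⊕ Fin m → Symb (2 * m) M} (hZ : S.IsLift z Z) {n : ℕ} (hn : 1 ≤ n)
    (γ : smoothAlg (2 * m) M) :
    ∃ X : Fin m ⊕ Fin m → Symb (2 * m) M,
      S.IsLift z (fun a => Z a + PowerSeries.X ^ n * X a) ∧
      ∀ a p, principal (X a) p = Ω.bracket γ.1 (fun q => (z a q : ℂ)) p := by
  obtain ⟨n, rfl⟩ := Nat.exists_eq_add_of_le' hn
  let A : Fin m ⊕ Fin m → Symb (2 * m) M := fun a => PowerSeries.C (hz.deriv a γ)
  obtain ⟨Z', hZ', hdvd⟩ := S.exists_isLift_of_X_pow_dvd_defect hM hz (n := n + 1)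
    (Z := fun a => Z a + PowerSeries.X ^ (n + 1) * A a)
    (fun a p => by
      rw [principal_add_X_pow_mul hn]
      exact hZ.2 a p)
    (fun a b => by
      rw [defect_add, S.isSDarboux_iff_defect.1 hZ.1, zero_add]
      refine dvd_add ?_ ?_
      · rw [pow_add _ (n + 1) 2]
        refine mul_dvd_mul_left _ ?_
        rw [X_sq_dvd_iff_coeff_one (dvd_add (S.X_dvd_comm _ _) (S.X_dvd_comm _ _)),
          S.coeff_one_comm_add_comm hz hZ.2]
        simp only [A, PowerSeries.coeff_zero_C]
        rw [hz.deriv_comm, sub_self, smul_zero]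
      · refine (pow_dvd_pow _ (by omega : n + 1 + 2 ≤ 2 * (n + 1) + 1)).trans ?_
        rw [pow_succ]
        exact mul_dvd_mul_left _ (S.X_dvd_comm _ _))
  choose R hR using hdvd
  -- `ħ^n` times this is the full change of `Z`, since the corrections to `A` start one order later
  refine ⟨fun a => A a + PowerSeries.X ^ 1 * R a, ?_, fun a p => ?_⟩
  · convert hZ' using 1
    funext a
    rw [← sub_add_cancel (Z' a) (Z a + PowerSeries.X ^ (n + 1) * A a), hR]
    ring
  · rw [principal_add_X_pow_mul le_rfl, ← hz.deriv_apply, principal, PowerSeries.coeff_zero_C]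

theorem exists_principal_eq_bracket (hM : TrivialCohomology (2 * m) M) (hz : IsDarboux Ω z)
    {Z X : Fin m ⊕ Fin m → Symb (2 * m) M} (hZ : S.IsLift z Z) {n : ℕ} (hn : 1 ≤ n)
    (hZX : S.IsLift z (fun a => Z a + PowerSeries.X ^ n * X a)) :
    ∃ γ : smoothAlg (2 * m) M,
      ∀ a p, principal (X a) p = Ω.bracket γ.1 (fun q => (z a q : ℂ)) p := by
  obtain ⟨γ, hγ⟩ := hz.exists_deriv_eq hM (x := fun a => PowerSeries.coeff 0 (X a))
    fun a b => by
      have h := S.isSDarboux_iff_defect.1 hZX.1 a b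
      rw [defect_add, S.isSDarboux_iff_defect.1 hZ.1, zero_add, two_mul n, pow_add, mul_assoc,
        ← mul_add] at h
      have h' := PowerSeries.X_pow_mul_cancel (h.trans (mul_zero _).symm)
      have hK : PowerSeries.X ^ 2 ∣ PowerSeries.X ^ n * S.comm (X a) (X b) := by
        rw [sq]
        exact mul_dvd_mul (dvd_pow_self _ (by omega)) (S.X_dvd_comm _ _)
      have h1 := congrArg (PowerSeries.coeff 1) h'
      rw [map_add, S.coeff_one_comm_add_comm hz hZ.2,
        PowerSeries.X_pow_dvd_iff.1 hK 1 (by norm_num), add_zero, map_zero,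
        smul_eq_zero_iff_right Complex.I_ne_zero, sub_eq_zero] at h1
      exact h1.symm
  exact ⟨γ, fun a p => by rw [← hz.deriv_apply, hγ]; rfl⟩

theorem exists_isLift_ne (hM : TrivialCohomology (2 * m) M) (hz : IsDarboux Ω z) (hm : 0 < m)
    [Nonempty M] {Z : Fin m ⊕ Fin m → Symb (2 * m) M} (hZ : S.IsLift z Z) :
    ∃ Z', S.IsLift z Z' ∧ Z' ≠ Z := by
  obtain ⟨p⟩ := ‹Nonempty M›
  obtain ⟨X, hX, hπ⟩ := S.exists_isLift_add_X_pow_mul hM hz hZ le_rfl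
    (hz.coord (Sum.inl ⟨0, hm⟩))
  -- the change generated by `γ = x` moves `p` by `{x, p} = 1` at first order
  refine ⟨_, hX, fun h => ?_⟩
  have h1 : X (Sum.inr ⟨0, hm⟩) = 0 := by
    have := congrFun h (Sum.inr ⟨0, hm⟩)
    rw [add_eq_left] at this
    exact PowerSeries.X_pow_mul_cancel (this.trans (mul_zero _).symm)
  have h2 := congrArg Complex.re (hπ (Sum.inr ⟨0, hm⟩) p)
  rw [h1, Ω.bracket_ofReal_right] at h2
  have h3 := h2.trans (hz.bracket_eq (Sum.inl ⟨0, hm⟩) (Sum.inr ⟨0, hm⟩) p)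
  simp [principal, canonicalJ] at h3

end Darboux

end StarProduct

end

theorem theorem1 {m : ℕ} {M : Type*} [TopologicalSpace M]
    [ChartedSpace (EuclideanSpace ℝ (Fin (2 * m))) M] [IsManifold (𝓡 (2 * m)) ∞ M]
    (hM : TrivialCohomology (2 * m) M)
    (Ω : SymplecticForm (2 * m) M) (S : StarProduct Ω)
    (z : Fin m ⊕ Fin m → M → ℝ) (hz : IsDarboux Ω z) :
    -- existence of a lift
    (∃ Z : Fin m ⊕ Fin m → Symb (2 * m) M, S.IsLift z Z) ∧
    -- the lift is never unique
    (0 < m → Nonempty M → ∀ Z, S.IsLift z Z → ∃ Z', S.IsLift z Z' ∧ Z' ≠ Z) ∧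
    -- every `γ` gives a change of the lift at order `ħ^n`
    (∀ Z, S.IsLift z Z → ∀ n : ℕ, 1 ≤ n → ∀ γ : smoothAlg (2 * m) M,
      ∃ X : Fin m ⊕ Fin m → Symb (2 * m) M,
        S.IsLift z (fun a => Z a + PowerSeries.X ^ n * X a) ∧
        ∀ a p, principal (X a) p = Ω.bracket γ.1 (fun q => (z a q : ℂ)) p) ∧
    -- and every change of the lift at order `ħ^n` arises in this way
    (∀ Z, S.IsLift z Z → ∀ n : ℕ, 1 ≤ n → ∀ X : Fin m ⊕ Fin m → Symb (2 * m) M,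
      S.IsLift z (fun a => Z a + PowerSeries.X ^ n * X a) →
      ∃ γ : smoothAlg (2 * m) M,
        ∀ a p, principal (X a) p = Ω.bracket γ.1 (fun q => (z a q : ℂ)) p) :=
  ⟨S.exists_isLift hM hz, fun hm _ _ hZ => S.exists_isLift_ne hM hz hm hZ,
    fun _ hZ _ hn γ => S.exists_isLift_add_X_pow_mul hM hz hZ hn γ,
    fun _ hZ _ hn _ hZX => S.exists_principal_eq_bracket hM hz hZ hn hZX⟩
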